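/- **Conventions.** Let $\mathcal G$ be a topological groupoid whose unit space $X=\mathcal G^{(0)}$ is compact and Hausdorff ($\mathcal G$ itself need be neither Hausdorff nor second countable), with range and source maps $r,s\colon\mathcal G\to X$. A *bisection* is a subset of $\mathcal G$ on which both $r$ and $s$ are injective. $\mathcal G$ is *étale* if $r$ is a local homeomorphism, and an étale groupoid is *ample* if its compact open bisections form a basis of its topology. An ample étale groupoid $\mathcal G$ is a *groupoid of germs* if, for every $g\in\mathcal G\setminus X$ and every compact open bisection $A\ni g$, there is $h\in A$ with $s(h)\neq r(h)$. It is *minimal* if $X$ is the only non-empty closed subset $C\subseteq X$ that is invariant, i.e. such that $s(g)\in C$ implies $r(g)\in C$ for all $g\in\mathcal G$. The *topological full group* $F(\mathcal G)$ is the group of all compact open bisections $A$ with $r(A)=s(A)=X$, under the product of subsets of $\mathcal G$. It acts on $X$ by letting $A$ send $s(a)$ to $r(a)$ for each $a\in A$. For a clopen set $U\subseteq X$ the *rigid stabiliser* $F(\mathcal G)_{(U)}$ is the subgroup of all elements of $F(\mathcal G)$ that fix every point of $X\setminus U$. Groups are regarded as discrete; a group $\Gamma$ is *amenable* if there is a left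 invariant mean on $\ell^\infty(\Gamma)$, and *$C^*$-simple* if its reduced $C^*$-algebra $C^*_r(\Gamma)\subseteq\mathbb B(\ell^2(\Gamma))$ (the norm closed $*$-algebra generated by the left regular representation) has no closed two-sided ideals other than $0$ and itself. **Theorem.** Let $\mathcal G$ be a minimal ample étale groupoid of germs with compact Hausdorff unit space $X$ having at least two points. If the rigid stabiliser $F(\mathcal G)_{(U)}$ is amenable for every clopen subset $U\subsetneq X$, then the group $F(\mathcal G)$ is not $C^*$-simple. -/

import Mathlib

open Set Topology
open scoped ENNReal

/-! ### Topological groupoids, ample étale groupoids -/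

/-- A topological groupoid with space of arrows `G` and unit space `X`, where `X` is included in
`G` by `unit`. The product of `g` and `h` is defined when `s g = r h`; it is
recorded by a total function `mul` of which only the values on composable pairs are ever used
(all laws, and the continuity, concern composable pairs only). Since `unit` is continuous with
continuous left inverse `r`, the topology of `X` is the subspace topology. -/
structure TopologicalGroupoid (X : Type*) (G : Type*) [TopologicalSpace X]
    [TopologicalSpace G] where
  /-- the inclusion of the unit space -/
  unit : X → G
  /-- the range map -/
  r : G → X
  /-- the source map -/
  s : G → X
  /-- the inverse -/
  inv : G → G
  /-- the product, meaningful on composable pairs -/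
  mul : G → G → G
  r_unit : ∀ x, r (unit x) = x
  s_unit : ∀ x, s (unit x) = x
  r_inv : ∀ g, r (inv g) = s g
  s_inv : ∀ g, s (inv g) = r g
  inv_inv : ∀ g, inv (inv g) = g
  r_mul : ∀ g h, s g = r h → r (mul g h) = r g
  s_mul : ∀ g h, s g = r h → s (mul g h) = s h
  mul_assoc : ∀ g h k, s g = r h → s h = r k → mul (mul g h) k = mul g (mul h k)
  unit_mul : ∀ g, mul (unit (r g)) g = g
  mul_unit : ∀ g, mul g (unit (s g)) = g
  mul_inv : ∀ g, mul g (inv g) = unit (r g)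
  inv_mul : ∀ g, mul (inv g) g = unit (s g)
  continuous_unit : Continuous unit
  continuous_r : Continuous r
  continuous_s : Continuous s
  continuous_inv : Continuous inv
  continuousOn_mul : ContinuousOn (fun p : G × G => mul p.1 p.2) {p | s p.1 = r p.2}

namespace TopologicalGroupoid

variable {X G : Type*} [TopologicalSpace X] [TopologicalSpace G]

/-- A bisection: a set of arrows on which both the range and the source map are injective. -/
def IsBisection (𝒢 : TopologicalGroupoid X G) (A : Set G) : Prop :=
  InjOn 𝒢.r A ∧ InjOn 𝒢.s A

/-- The compact open bisections (the ample bisections). -/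
def compactOpenBisections (𝒢 : TopologicalGroupoid X G) : Set (Set G) :=
  {A | IsCompact A ∧ IsOpen A ∧ 𝒢.IsBisection A}

/-- The groupoid is étale: the range map is a local homeomorphism. -/
def IsEtale (𝒢 : TopologicalGroupoid X G) : Prop :=
  IsLocalHomeomorph 𝒢.r

/-- Ample: the compact open bisections are a basis of the topology. -/
def IsAmple (𝒢 : TopologicalGroupoid X G) : Prop :=
  TopologicalSpace.IsTopologicalBasis 𝒢.compactOpenBisections

/-- A groupoid of germs (effective groupoid): every compact open bisection that contains a
non-unit arrow contains an arrow whose source and range are different. -/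
def IsGroupoidOfGerms (𝒢 : TopologicalGroupoid X G) : Prop :=
  ∀ g : G, g ∉ range 𝒢.unit → ∀ A ∈ 𝒢.compactOpenBisections, g ∈ A →
    ∃ h ∈ A, 𝒢.s h ≠ 𝒢.r h

/-- A set of units is invariant if it contains the range of each arrow whose source it contains. -/
def IsInvariant (𝒢 : TopologicalGroupoid X G) (C : Set X) : Prop :=
  ∀ g : G, 𝒢.s g ∈ C → 𝒢.r g ∈ C

/-- Minimal: the only non-empty closed invariant set of units is the whole unit space. -/
def IsMinimal (𝒢 : TopologicalGroupoid X G) : Prop :=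
  ∀ C : Set X, IsClosed C → C.Nonempty → 𝒢.IsInvariant C → C = univ

/-- The product of two sets of arrows. -/
def setMul (𝒢 : TopologicalGroupoid X G) (A B : Set G) : Set G :=
  {g | ∃ a ∈ A, ∃ b ∈ B, 𝒢.s a = 𝒢.r b ∧ 𝒢.mul a b = g}

end TopologicalGroupoid

/-- An ample étale groupoid. -/
structure AmpleGroupoid (X : Type*) (G : Type*) [TopologicalSpace X] [TopologicalSpace G]
    extends TopologicalGroupoid X G where
  isEtale : toTopologicalGroupoid.IsEtale
  isAmple : toTopologicalGroupoid.IsAmple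

/-! ### The topological full group -/

/-- The elements of the topological full group: the compact open bisections whose source and
range are the whole unit space, that is, the group of units of the inverse monoid of compact open
bisections. -/
@[ext]
structure TopologicalFullGroup {X G : Type*} [TopologicalSpace X] [TopologicalSpace G]
    (𝒢 : AmpleGroupoid X G) where
  /-- the underlying set of arrows -/
  carrier : Set G
  isCompact : IsCompact carrier
  isOpen : IsOpen carrier
  isBisection : 𝒢.IsBisection carrier
  image_r : 𝒢.r '' carrier = univ
  image_s : 𝒢.s '' carrier = univ

namespace AmpleGroupoid

variable {X G : Type*} [TopologicalSpace X] [TopologicalSpace G] (𝒢 : AmpleGroupoid X G)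

theorem isOpen_range_unit : IsOpen (range 𝒢.unit) := by
  have h : IsOpenEmbedding 𝒢.unit := by
    refine IsLocalHomeomorph.isOpenEmbedding_of_comp (g := 𝒢.r) 𝒢.isEtale ?_ 𝒢.continuous_unit
    have : 𝒢.r ∘ 𝒢.unit = id := funext 𝒢.r_unit
    rw [this]
    exact IsOpenEmbedding.id
  exact h.isOpen_range

theorem mul_inv_cancel_left' {a g : G} (h : 𝒢.r a = 𝒢.r g) :
    𝒢.mul a (𝒢.mul (𝒢.inv a) g) = g := by
  rw [← 𝒢.mul_assoc _ _ _ (𝒢.r_inv a).symm ((𝒢.s_inv a).trans h), 𝒢.mul_inv, h, 𝒢.unit_mul]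

theorem inv_mul_cancel_left' {a b : G} (h : 𝒢.s a = 𝒢.r b) :
    𝒢.mul (𝒢.inv a) (𝒢.mul a b) = b := by
  rw [← 𝒢.mul_assoc _ _ _ (𝒢.s_inv a) h, 𝒢.inv_mul, h, 𝒢.unit_mul]

theorem mul_inv_cancel_right' {a b : G} (h : 𝒢.s a = 𝒢.r b) :
    𝒢.mul (𝒢.mul a b) (𝒢.inv b) = a := by
  rw [𝒢.mul_assoc _ _ _ h (𝒢.r_inv b).symm, 𝒢.mul_inv, ← h, 𝒢.mul_unit]

end AmpleGroupoid

namespace TopologicalFullGroup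

variable {X G : Type*} [TopologicalSpace X] [TopologicalSpace G] {𝒢 : AmpleGroupoid X G}

theorem exists_r (A : TopologicalFullGroup 𝒢) (x : X) : ∃ a ∈ A.carrier, 𝒢.r a = x := by
  have : x ∈ 𝒢.r '' A.carrier := by rw [A.image_r]; trivial
  exact this

theorem exists_s (A : TopologicalFullGroup 𝒢) (x : X) : ∃ a ∈ A.carrier, 𝒢.s a = x := by
  have : x ∈ 𝒢.s '' A.carrier := by rw [A.image_s]; trivial
  exact this

theorem isOpen_setMul (A : TopologicalFullGroup 𝒢) {B : Set G} (hB : IsOpen B) :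
    IsOpen (𝒢.setMul A.carrier B) := by
  choose σ hσA hσr using A.exists_r
  have hσ : Continuous σ := by
    rw [continuous_def]
    intro W hW
    have : σ ⁻¹' W = 𝒢.r '' (W ∩ A.carrier) := by
      ext x
      constructor
      · intro hx
        exact ⟨σ x, ⟨hx, hσA x⟩, hσr x⟩
      · rintro ⟨a, ⟨haW, haA⟩, rfl⟩
        have : σ (𝒢.r a) = a := A.isBisection.1 (hσA _) haA (hσr _)
        simpa [this] using haW
    rw [this]
    exact (IsLocalHomeomorph.isOpenMap 𝒢.isEtale) _ (hW.inter A.isOpen)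
  have hc : Continuous fun g : G => 𝒢.mul (𝒢.inv (σ (𝒢.r g))) g := by
    refine 𝒢.continuousOn_mul.comp_continuous
      (f := fun g : G => (𝒢.inv (σ (𝒢.r g)), g)) ?_ ?_
    · exact (𝒢.continuous_inv.comp (hσ.comp 𝒢.continuous_r)).prodMk continuous_id
    · intro g
      simp [𝒢.s_inv, hσr]
  have : 𝒢.setMul A.carrier B = (fun g : G => 𝒢.mul (𝒢.inv (σ (𝒢.r g))) g) ⁻¹' B := by
    ext g
    constructor
    · rintro ⟨a, ha, b, hb, hab, rfl⟩
      have h1 : σ (𝒢.r (𝒢.mul a b)) = a :=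
        A.isBisection.1 (hσA _) ha (by rw [hσr, 𝒢.r_mul _ _ hab])
      simpa [h1, 𝒢.inv_mul_cancel_left' hab] using hb
    · intro hg
      have h1 : 𝒢.s (𝒢.inv (σ (𝒢.r g))) = 𝒢.r g := by rw [𝒢.s_inv, hσr]
      exact ⟨σ (𝒢.r g), hσA _, _, hg, by rw [𝒢.r_mul _ _ h1, 𝒢.r_inv],
        𝒢.mul_inv_cancel_left' (hσr _)⟩
  rw [this]
  exact hB.preimage hc

theorem isCompact_setMul [T2Space X] (A B : TopologicalFullGroup 𝒢) :
    IsCompact (𝒢.setMul A.carrier B.carrier) := by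
  have hcl : IsClosed {p : G × G | 𝒢.s p.1 = 𝒢.r p.2} :=
    isClosed_eq (𝒢.continuous_s.comp continuous_fst) (𝒢.continuous_r.comp continuous_snd)
  have hK := (A.isCompact.prod B.isCompact).inter_right hcl
  have := hK.image_of_continuousOn (𝒢.continuousOn_mul.mono inter_subset_right)
  convert this using 1
  ext g
  constructor
  · rintro ⟨a, ha, b, hb, hab, rfl⟩
    exact ⟨(a, b), ⟨⟨ha, hb⟩, hab⟩, rfl⟩
  · rintro ⟨⟨a, b⟩, ⟨⟨ha, hb⟩, hab⟩, rfl⟩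
    exact ⟨a, ha, b, hb, hab, rfl⟩

/-- The product of two bisections is their product as sets of arrows. -/
instance [T2Space X] : Mul (TopologicalFullGroup 𝒢) where
  mul A B :=
    { carrier := 𝒢.setMul A.carrier B.carrier
      isCompact := isCompact_setMul A B
      isOpen := A.isOpen_setMul B.isOpen
      isBisection := by
        constructor
        · rintro _ ⟨a, ha, b, hb, hab, rfl⟩ _ ⟨c, hc, d, hd, hcd, rfl⟩ h
          rw [𝒢.r_mul _ _ hab, 𝒢.r_mul _ _ hcd] at h
          obtain rfl := A.isBisection.1 ha hc h
          obtain rfl := B.isBisection.1 hb hd (hab.symm.trans hcd)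
          rfl
        · rintro _ ⟨a, ha, b, hb, hab, rfl⟩ _ ⟨c, hc, d, hd, hcd, rfl⟩ h
          rw [𝒢.s_mul _ _ hab, 𝒢.s_mul _ _ hcd] at h
          obtain rfl := B.isBisection.2 hb hd h
          obtain rfl := A.isBisection.2 ha hc (hab.trans hcd.symm)
          rfl
      image_r := by
        refine eq_univ_of_forall fun x => ?_
        obtain ⟨a, ha, rfl⟩ := A.exists_r x
        obtain ⟨b, hb, hab⟩ := B.exists_r (𝒢.s a)
        exact ⟨_, ⟨a, ha, b, hb, hab.symm, rfl⟩, 𝒢.r_mul _ _ hab.symm⟩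
      image_s := by
        refine eq_univ_of_forall fun x => ?_
        obtain ⟨b, hb, rfl⟩ := B.exists_s x
        obtain ⟨a, ha, hab⟩ := A.exists_s (𝒢.r b)
        exact ⟨_, ⟨a, ha, b, hb, hab, rfl⟩, 𝒢.s_mul _ _ hab⟩ }

/-- The identity is the unit space. -/
instance [CompactSpace X] : One (TopologicalFullGroup 𝒢) where
  one :=
    { carrier := range 𝒢.unit
      isCompact := isCompact_range 𝒢.continuous_unit
      isOpen := 𝒢.isOpen_range_unit
      isBisection := by
        constructor
        · rintro _ ⟨x, rfl⟩ _ ⟨y, rfl⟩ h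
          rw [𝒢.r_unit, 𝒢.r_unit] at h
          rw [h]
        · rintro _ ⟨x, rfl⟩ _ ⟨y, rfl⟩ h
          rw [𝒢.s_unit, 𝒢.s_unit] at h
          rw [h]
      image_r := eq_univ_of_forall fun x => ⟨_, ⟨x, rfl⟩, 𝒢.r_unit x⟩
      image_s := eq_univ_of_forall fun x => ⟨_, ⟨x, rfl⟩, 𝒢.s_unit x⟩ }

/-- The inverse is the set of inverse arrows. -/
instance : Inv (TopologicalFullGroup 𝒢) where
  inv A :=
    { carrier := 𝒢.inv '' A.carrier
      isCompact := A.isCompact.image 𝒢.continuous_inv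
      isOpen := by
        have : 𝒢.inv '' A.carrier = 𝒢.inv ⁻¹' A.carrier :=
          congrFun (image_eq_preimage_of_inverse 𝒢.inv_inv 𝒢.inv_inv) A.carrier
        rw [this]
        exact A.isOpen.preimage 𝒢.continuous_inv
      isBisection := by
        constructor
        · rintro _ ⟨a, ha, rfl⟩ _ ⟨b, hb, rfl⟩ h
          rw [𝒢.r_inv, 𝒢.r_inv] at h
          rw [A.isBisection.2 ha hb h]
        · rintro _ ⟨a, ha, rfl⟩ _ ⟨b, hb, rfl⟩ h
          rw [𝒢.s_inv, 𝒢.s_inv] at h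
          rw [A.isBisection.1 ha hb h]
      image_r := by
        refine eq_univ_of_forall fun x => ?_
        obtain ⟨a, ha, rfl⟩ := A.exists_s x
        exact ⟨_, ⟨a, ha, rfl⟩, 𝒢.r_inv a⟩
      image_s := by
        refine eq_univ_of_forall fun x => ?_
        obtain ⟨a, ha, rfl⟩ := A.exists_r x
        exact ⟨_, ⟨a, ha, rfl⟩, 𝒢.s_inv a⟩ }

theorem mul_carrier [T2Space X] (A B : TopologicalFullGroup 𝒢) :
    (A * B).carrier = 𝒢.setMul A.carrier B.carrier := rfl

theorem one_carrier [CompactSpace X] :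
    (1 : TopologicalFullGroup 𝒢).carrier = range 𝒢.unit := rfl

theorem inv_carrier (A : TopologicalFullGroup 𝒢) :
    (A⁻¹).carrier = 𝒢.inv '' A.carrier := rfl

/-- The topological full group, as a group. -/
instance [CompactSpace X] [T2Space X] : Group (TopologicalFullGroup 𝒢) :=
  Group.ofLeftAxioms
    (by
      intro A B C
      ext g
      simp only [mul_carrier]
      constructor
      · rintro ⟨_, ⟨a, ha, b, hb, hab, rfl⟩, c, hc, h, rfl⟩
        rw [𝒢.s_mul _ _ hab] at h
        exact ⟨a, ha, _, ⟨b, hb, c, hc, h, rfl⟩, by rw [hab, 𝒢.r_mul _ _ h],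
          (𝒢.mul_assoc _ _ _ hab h).symm⟩
      · rintro ⟨a, ha, _, ⟨b, hb, c, hc, hbc, rfl⟩, h, rfl⟩
        rw [𝒢.r_mul _ _ hbc] at h
        exact ⟨_, ⟨a, ha, b, hb, h, rfl⟩, c, hc, by rw [𝒢.s_mul _ _ h, hbc],
          𝒢.mul_assoc _ _ _ h hbc⟩)
    (by
      intro A
      ext g
      simp only [mul_carrier, one_carrier]
      constructor
      · rintro ⟨_, ⟨x, rfl⟩, a, ha, h, rfl⟩
        rw [𝒢.s_unit] at h
        rw [h, 𝒢.unit_mul]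
        exact ha
      · intro hg
        exact ⟨_, ⟨𝒢.r g, rfl⟩, g, hg, 𝒢.s_unit _, 𝒢.unit_mul g⟩)
    (by
      intro A
      ext g
      simp only [mul_carrier, one_carrier, inv_carrier]
      constructor
      · rintro ⟨_, ⟨a, ha, rfl⟩, b, hb, h, rfl⟩
        rw [𝒢.s_inv] at h
        obtain rfl := A.isBisection.1 ha hb h
        exact ⟨𝒢.s a, (𝒢.inv_mul a).symm⟩
      · rintro ⟨x, rfl⟩
        obtain ⟨a, ha, rfl⟩ := A.exists_s x
        exact ⟨_, ⟨a, ha, rfl⟩, a, ha, 𝒢.s_inv a, 𝒢.inv_mul a⟩)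

/-- The action of the full group on the unit space: `A` sends the source of each of its arrows
to the range of this arrow. -/
noncomputable instance : SMul (TopologicalFullGroup 𝒢) X where
  smul A x := 𝒢.r (A.exists_s x).choose

theorem smul_source (A : TopologicalFullGroup 𝒢) {a : G} (ha : a ∈ A.carrier) :
    A • 𝒢.s a = 𝒢.r a := by
  have h := (A.exists_s (𝒢.s a)).choose_spec
  exact congrArg 𝒢.r (A.isBisection.2 h.1 ha h.2)

noncomputable instance [CompactSpace X] [T2Space X] : MulAction (TopologicalFullGroup 𝒢) X where
  one_smul x := by
    have := smul_source (1 : TopologicalFullGroup 𝒢) (a := 𝒢.unit x) ⟨x, rfl⟩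
    rwa [𝒢.s_unit, 𝒢.r_unit] at this
  mul_smul A B x := by
    obtain ⟨b, hb, rfl⟩ := B.exists_s x
    obtain ⟨a, ha, hab⟩ := A.exists_s (𝒢.r b)
    have := smul_source (A * B) (a := 𝒢.mul a b) ⟨a, ha, b, hb, hab, rfl⟩
    rw [𝒢.s_mul _ _ hab, 𝒢.r_mul _ _ hab] at this
    rw [this, smul_source B hb, ← hab, smul_source A ha]

/-- The rigid stabiliser of `U`: the elements of the full group which act trivially on the
complement of `U`. -/
noncomputable def rigidStabiliser [CompactSpace X] [T2Space X] (𝒢 : AmpleGroupoid X G)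
    (U : Set X) : Subgroup (TopologicalFullGroup 𝒢) :=
  fixingSubgroup (TopologicalFullGroup 𝒢) Uᶜ

end TopologicalFullGroup

/-! ### Amenable groups -/

/-- A (discrete) group is amenable if there is a left invariant mean on its bounded functions. -/
def IsAmenableGroup (Γ : Type*) [Group Γ] : Prop :=
  ∃ m : lp (fun _ : Γ => ℝ) ∞ →ₗ[ℝ] ℝ,
    (∀ f, (∀ x, 0 ≤ f x) → 0 ≤ m f) ∧
    m 1 = 1 ∧
    ∀ (g : Γ) (f f' : lp (fun _ : Γ => ℝ) ∞), (∀ x, f' x = f (g⁻¹ * x)) → m f' = m f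

/-! ### The reduced group C*-algebra -/

section Reduced

variable (Γ : Type*) [Group Γ]

theorem leftTranslate_memℓp {Γ : Type*} [Group Γ] (g : Γ) (f : lp (fun _ : Γ => ℂ) 2) :
    Memℓp (fun x => f (g⁻¹ * x)) 2 := by
  have h := (lp.memℓp f).summable (by norm_num)
  exact memℓp_gen (h.comp_injective (mul_right_injective g⁻¹))

/-- Left translation by `g` on the square summable functions, `f ↦ (x ↦ f (g⁻¹ x))`. -/
noncomputable def leftTranslate {Γ : Type*} [Group Γ] (g : Γ) :
    lp (fun _ : Γ => ℂ) 2 →ₗᵢ[ℂ] lp (fun _ : Γ => ℂ) 2 where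
  toFun f := ⟨fun x => f (g⁻¹ * x), leftTranslate_memℓp g f⟩
  map_add' _ _ := rfl
  map_smul' _ _ := rfl
  norm_map' f := by
    rw [lp.norm_eq_tsum_rpow (by norm_num), lp.norm_eq_tsum_rpow (by norm_num)]
    congr 1
    exact (Equiv.mulLeft g⁻¹).tsum_eq (fun x => ‖f x‖ ^ (2 : ℝ≥0∞).toReal)

/-- The left regular representation, by bounded operators. -/
noncomputable def leftRegularRepresentation :
    Γ →* (lp (fun _ : Γ => ℂ) 2 →L[ℂ] lp (fun _ : Γ => ℂ) 2) where
  toFun g := (leftTranslate g).toContinuousLinearMap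
  map_one' := by
    ext f x
    simp [leftTranslate]
  map_mul' g h := by
    ext f x
    change f ((g * h)⁻¹ * x) = f (h⁻¹ * (g⁻¹ * x))
    rw [mul_inv_rev, _root_.mul_assoc]

/-- The reduced group C*-algebra: the norm closed *-subalgebra of bounded operators generated by
the left regular representation. -/
noncomputable def reducedGroupCStarAlgebra :
    StarSubalgebra ℂ (lp (fun _ : Γ => ℂ) 2 →L[ℂ] lp (fun _ : Γ => ℂ) 2) :=
  (StarAlgebra.adjoin ℂ (range (leftRegularRepresentation Γ))).topologicalClosure

/-- A group is C*-simple if its reduced C*-algebra (which is never zero) has no closed two-sided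
ideals besides zero and itself. -/
def IsCStarSimpleGroup : Prop :=
  ∀ I : TwoSidedIdeal (reducedGroupCStarAlgebra Γ),
    IsClosed (I : Set (reducedGroupCStarAlgebra Γ)) → I = ⊥ ∨ I = ⊤

end Reduced

/-! Fix a unit `x` and let `H` consist of the elements supported in a clopen set that misses `x`.
Finitely many of them lie in one rigid stabiliser of a proper clopen set, which is amenable; hence
`H` has almost invariant unit vectors in ℓ² (`exists_filter_almost_invariant`). If `X` is infinite,
minimality gives infinite orbits and thus nontrivial `A`, `B` with disjoint clopen supports
(`exists_disjoint_rigidStabiliser_ne_one`); they commute because the action is faithful. For every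
`C` the point `C • x` misses one of the two supports, so `C⁻¹ * A * C` or `C⁻¹ * B * C` lies in `H`.
Therefore the nonzero operator (1 - λ(A))(1 - λ(B)) sends every translate of the almost invariant
vectors to zero in the limit. The operators that do so after each element of the reduced algebra
form a closed ideal; it contains this product but not 1 (`not_isCStarSimpleGroup_of_tendsto`). If
`X` is finite, the group is finite and nontrivial, and the same argument runs with `H` everything
and `A = B`. -/

section

open Filter

/-! ### The regular representation and ideals of the reduced C*-algebra -/

section RegularRepresentation

variable {Γ : Type*} [Group Γ]

theorem leftRegularRepresentation_apply (g : Γ) (ξ : lp (fun _ : Γ => ℂ) 2) (x : Γ) :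
    leftRegularRepresentation Γ g ξ x = ξ (g⁻¹ * x) := rfl

theorem norm_leftRegularRepresentation_apply (g : Γ) (ξ : lp (fun _ : Γ => ℂ) 2) :
    ‖leftRegularRepresentation Γ g ξ‖ = ‖ξ‖ :=
  (leftTranslate g).norm_map ξ

theorem leftRegularRepresentation_mul_apply (g h : Γ) (ξ : lp (fun _ : Γ => ℂ) 2) :
    leftRegularRepresentation Γ (g * h) ξ =
      leftRegularRepresentation Γ g (leftRegularRepresentation Γ h ξ) := by
  rw [map_mul]; rfl

/-- An invertible isometry is unitary. Consequently adjoints add no generators beyond the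
translations. -/
theorem star_leftRegularRepresentation (g : Γ) :
    star (leftRegularRepresentation Γ g) = leftRegularRepresentation Γ g⁻¹ := by
  have h : star (leftRegularRepresentation Γ g) * leftRegularRepresentation Γ g = 1 :=
    (ContinuousLinearMap.norm_map_iff_adjoint_comp_self _).1
      (norm_leftRegularRepresentation_apply g)
  calc star (leftRegularRepresentation Γ g)
      = star (leftRegularRepresentation Γ g) *
          (leftRegularRepresentation Γ g * leftRegularRepresentation Γ g⁻¹) := by
        rw [← map_mul, mul_inv_cancel, map_one, mul_one]
    _ = leftRegularRepresentation Γ g⁻¹ := by rw [← mul_assoc, h, one_mul]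

theorem leftRegularRepresentation_mem (g : Γ) :
    leftRegularRepresentation Γ g ∈ reducedGroupCStarAlgebra Γ :=
  StarSubalgebra.le_topologicalClosure _ (StarAlgebra.subset_adjoin ℂ _ ⟨g, rfl⟩)

/-- The operators that tend to zero along a filter of bounded vectors form a closed set. -/
theorem isClosed_setOf_tendsto_zero {E : Type*} [NormedAddCommGroup E] [NormedSpace ℂ E]
    {F : Filter E} (hF : ∀ᶠ ξ in F, ‖ξ‖ = 1) :
    IsClosed {T : E →L[ℂ] E | Tendsto T F (𝓝 0)} := by
  refine isClosed_of_closure_subset fun T hT => ?_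
  rw [mem_ofPred_eq, Metric.tendsto_nhds]
  intro ε hε
  obtain ⟨S, hS, hST⟩ := Metric.mem_closure_iff.1 hT (ε / 2) (half_pos hε)
  filter_upwards [hF, Metric.tendsto_nhds.1 hS (ε / 2) (half_pos hε)] with ξ h1 h2
  rw [dist_zero_right] at h2 ⊢
  rw [dist_eq_norm] at hST
  have h3 : ‖(T - S) ξ‖ ≤ ‖T - S‖ := by simpa [h1] using (T - S).le_opNorm ξ
  have h4 : T ξ = (T - S) ξ + S ξ := by simp
  rw [h4]
  linarith [norm_add_le ((T - S) ξ) (S ξ)]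

/-- The admissible `b` form a closed set, so it suffices to treat the *-algebra generated by the
translations, by induction on its elements. -/
theorem tendsto_apply_of_mem_reducedGroupCStarAlgebra {F : Filter (lp (fun _ : Γ => ℂ) 2)}
    (hF : ∀ᶠ ξ in F, ‖ξ‖ = 1) {T b : lp (fun _ : Γ => ℂ) 2 →L[ℂ] lp (fun _ : Γ => ℂ) 2}
    (h : ∀ g, Tendsto (fun ξ => T (leftRegularRepresentation Γ g ξ)) F (𝓝 0))
    (hb : b ∈ reducedGroupCStarAlgebra Γ) : Tendsto (fun ξ => T (b ξ)) F (𝓝 0) := by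
  have hcl : IsClosed {b : lp (fun _ : Γ => ℂ) 2 →L[ℂ] lp (fun _ : Γ => ℂ) 2 |
      Tendsto (fun ξ => T (b ξ)) F (𝓝 0)} :=
    (isClosed_setOf_tendsto_zero hF).preimage (continuous_const_mul T)
  refine closure_minimal ?_ hcl hb
  intro c hc
  have hc' : c ∈ Algebra.adjoin ℂ (range (leftRegularRepresentation Γ) ∪
    star (range (leftRegularRepresentation Γ))) := hc
  -- Quantifying over `T` lets the product case use `T * c` in place of `T`; quantifying over `g`
  -- lets a generator be absorbed into the translation.
  have key : ∀ T : lp (fun _ : Γ => ℂ) 2 →L[ℂ] lp (fun _ : Γ => ℂ) 2,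
      (∀ g, Tendsto (fun ξ => T (leftRegularRepresentation Γ g ξ)) F (𝓝 0)) →
      ∀ g, Tendsto (fun ξ => T (c (leftRegularRepresentation Γ g ξ))) F (𝓝 0) := by
    clear hcl hb hc h T
    induction hc' using Algebra.adjoin_induction with
    | mem c hc =>
      intro T h g
      have : ∃ k, c = leftRegularRepresentation Γ k := by
        rcases hc with ⟨k, rfl⟩ | ⟨k, hk⟩
        · exact ⟨k, rfl⟩
        · exact ⟨k⁻¹, by rw [← star_leftRegularRepresentation, hk, star_star]⟩
      obtain ⟨k, rfl⟩ := this
      simpa only [leftRegularRepresentation_mul_apply] using h (k * g)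
    | algebraMap z =>
      intro T h g
      simpa [Algebra.algebraMap_eq_smul_one] using (h g).const_smul z
    | add c d _ _ hc hd =>
      intro T h g
      simpa using (hc T h g).add (hd T h g)
    | mul c d _ _ hc hd =>
      intro T h g
      exact hd (T * c) (hc T h) g
  simpa using key T h 1

/-- If a nonzero element of the reduced C*-algebra sends all translates of a filter of unit
vectors to zero, then it lies in a proper closed ideal. -/
theorem not_isCStarSimpleGroup_of_tendsto {F : Filter (lp (fun _ : Γ => ℂ) 2)} [F.NeBot]
    (hF : ∀ᶠ ξ in F, ‖ξ‖ = 1) {T : lp (fun _ : Γ => ℂ) 2 →L[ℂ] lp (fun _ : Γ => ℂ) 2}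
    (hT : T ∈ reducedGroupCStarAlgebra Γ) (hT0 : T ≠ 0)
    (h : ∀ g, Tendsto (fun ξ => T (leftRegularRepresentation Γ g ξ)) F (𝓝 0)) :
    ¬ IsCStarSimpleGroup Γ := by
  intro hs
  -- Plain convergence to zero gives only a left ideal; demanding it after every `b` makes the ideal
  -- two-sided.
  let I : TwoSidedIdeal (reducedGroupCStarAlgebra Γ) := TwoSidedIdeal.mk'
    {S | ∀ b : reducedGroupCStarAlgebra Γ, Tendsto (fun ξ => S.1 (b.1 ξ)) F (𝓝 0)}
    (fun b => by simp)
    (fun {x y} hx hy b => by simpa using (hx b).add (hy b))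
    (fun {x} hx b => by simpa using (hx b).neg)
    (fun {x y} hy b => by
      have := (x.1.continuous.tendsto 0).comp (hy b)
      rwa [map_zero] at this)
    (fun {x y} hx b => hx (y * b))
  have hmem : ∀ S, S ∈ I ↔ ∀ b : reducedGroupCStarAlgebra Γ,
      Tendsto (fun ξ => S.1 (b.1 ξ)) F (𝓝 0) := fun S => by
    simp [I, TwoSidedIdeal.mem_mk']
  have hcl : IsClosed (I : Set (reducedGroupCStarAlgebra Γ)) := by
    have : (I : Set (reducedGroupCStarAlgebra Γ)) = ⋂ b : reducedGroupCStarAlgebra Γ,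
        (fun S : reducedGroupCStarAlgebra Γ => S.1 * b.1) ⁻¹'
          {T | Tendsto T F (𝓝 0)} := by
      ext S
      simp only [SetLike.mem_coe, hmem, mem_iInter]
      rfl
    rw [this]
    exact isClosed_iInter fun b => (isClosed_setOf_tendsto_zero hF).preimage
      (continuous_subtype_val.mul continuous_const)
  rcases hs I hcl with hI | hI
  · have : (⟨T, hT⟩ : reducedGroupCStarAlgebra Γ) ∈ I :=
      (hmem _).2 fun b => tendsto_apply_of_mem_reducedGroupCStarAlgebra hF h b.2
    rw [hI, TwoSidedIdeal.mem_bot] at this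
    exact hT0 (congrArg Subtype.val this)
  · have : (1 : reducedGroupCStarAlgebra Γ) ∈ I := by rw [hI]; trivial
    have h1 : Tendsto (fun ξ => ξ) F (𝓝 0) := by simpa using (hmem _).1 this 1
    have h2 := h1.norm
    rw [norm_zero] at h2
    have h3 : Tendsto (fun ξ : lp (fun _ : Γ => ℂ) 2 => ‖ξ‖) F (𝓝 1) :=
      tendsto_const_nhds.congr' (hF.mono fun ξ hξ => hξ.symm)
    exact one_ne_zero (tendsto_nhds_unique h3 h2)

/-- Applied to the point mass at 1, the product has value 2 or 1 at 1, according to whether `a * b =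
1`. -/
theorem one_sub_mul_one_sub_leftRegularRepresentation_ne_zero {a b : Γ} (ha : a ≠ 1)
    (hb : b ≠ 1) :
    (1 - leftRegularRepresentation Γ a) * (1 - leftRegularRepresentation Γ b) ≠ 0 := by
  classical
  intro h
  have h1 := congrArg (fun T => (T (lp.single 2 (1 : Γ) (1 : ℂ)) : Γ → ℂ) 1) h
  have h2 : (1 - leftRegularRepresentation Γ a) * (1 - leftRegularRepresentation Γ b) =
      1 - leftRegularRepresentation Γ a - leftRegularRepresentation Γ b +
        leftRegularRepresentation Γ (a * b) := by
    rw [map_mul]; noncomm_ring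
  rw [h2] at h1
  simp only [add_apply, sub_apply,
    one_apply_eq_self, zero_apply, lp.coeFn_add, lp.coeFn_sub,
    Pi.add_apply, Pi.sub_apply, leftRegularRepresentation_apply, lp.coeFn_zero, Pi.zero_apply,
    lp.coeFn_single, mul_one, Pi.single_eq_same] at h1
  rw [Pi.single_eq_of_ne (inv_ne_one.2 ha), Pi.single_eq_of_ne (inv_ne_one.2 hb),
    Pi.single_apply] at h1
  split_ifs at h1 <;> norm_num at h1

/-- A group is not C*-simple if it has almost invariant vectors for a set which
contains each conjugate of `a` or `b`, for two commuting nontrivial elements `a` and `b`. -/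
theorem not_isCStarSimpleGroup_of_commute {H : Set Γ} {F : Filter (lp (fun _ : Γ => ℂ) 2)}
    [F.NeBot] (hF : ∀ᶠ ξ in F, ‖ξ‖ = 1)
    (hH : ∀ h ∈ H, Tendsto (fun ξ => leftRegularRepresentation Γ h ξ - ξ) F (𝓝 0))
    {a b : Γ} (ha : a ≠ 1) (hb : b ≠ 1) (hab : Commute a b)
    (hconj : ∀ g, g⁻¹ * a * g ∈ H ∨ g⁻¹ * b * g ∈ H) : ¬ IsCStarSimpleGroup Γ := by
  have hmem : ∀ c : Γ, 1 - leftRegularRepresentation Γ c ∈ reducedGroupCStarAlgebra Γ :=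
    fun c => sub_mem (one_mem _) (leftRegularRepresentation_mem c)
  have key : ∀ c g : Γ, g⁻¹ * c * g ∈ H → Tendsto (fun ξ =>
      (1 - leftRegularRepresentation Γ c) (leftRegularRepresentation Γ g ξ)) F (𝓝 0) := by
    intro c g hg
    -- (1 - λ(c))λ(g)ξ = -λ(g)(λ(g⁻¹cg)ξ - ξ).
    have h1 := ((leftRegularRepresentation Γ g).continuous.tendsto 0).comp (hH _ hg)
    rw [map_zero] at h1
    have h2 := h1.neg
    rw [neg_zero] at h2
    refine h2.congr fun ξ => ?_
    simp only [Function.comp_apply, map_sub, ← leftRegularRepresentation_mul_apply, neg_sub,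
      sub_apply, one_apply_eq_self]
    congr 3
    group
  have hcomm : Commute (1 - leftRegularRepresentation Γ a) (1 - leftRegularRepresentation Γ b) :=
    ((Commute.one_left _).sub_left ((Commute.one_right _).sub_right (hab.map _)))
  refine not_isCStarSimpleGroup_of_tendsto hF (mul_mem (hmem a) (hmem b))
    (one_sub_mul_one_sub_leftRegularRepresentation_ne_zero ha hb) fun g => ?_
  -- As the factors commute, the one known to annihilate in the limit can act first.
  rcases hconj g with hg | hg
  · rw [hcomm.eq]
    have := ((1 - leftRegularRepresentation Γ b).continuous.tendsto 0).comp (key a g hg)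
    rwa [map_zero] at this
  · have := ((1 - leftRegularRepresentation Γ a).continuous.tendsto 0).comp (key b g hg)
    rwa [map_zero] at this

end RegularRepresentation

/-! ### From invariant means to almost invariant vectors -/

section Amenable

variable {Γ : Type*} [Group Γ]

/-- Finite groups are amenable: the mean is the average. -/
theorem IsAmenableGroup.of_finite (Γ : Type*) [Group Γ] [Finite Γ] : IsAmenableGroup Γ := by
  have := Fintype.ofFinite Γ
  refine ⟨{ toFun := fun f => (∑ x, f x) / Fintype.card Γ
            map_add' := fun f g => by
              simp only [lp.coeFn_add, Pi.add_apply]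
              rw [Finset.sum_add_distrib, add_div]
            map_smul' := fun c f => by simp [← Finset.mul_sum, mul_div_assoc] }, ?_, ?_, ?_⟩
  · intro f hf
    exact div_nonneg (Finset.sum_nonneg fun x _ => hf x) (Nat.cast_nonneg _)
  · simp [lp.infty_coeFn_one]
  · intro g f f' h
    simp only [LinearMap.coe_mk, AddHom.coe_mk]
    congr 1
    simp only [h]
    exact Equiv.sum_comp (Equiv.mulLeft g⁻¹) fun x => f x

/-- On an amenable group no finite sum of functions `φ h (h x) - φ h x` is bounded below by a
positive constant. -/
theorem IsAmenableGroup.sum_translate_sub_le {ι : Type*} [Fintype ι] (hΓ : IsAmenableGroup Γ)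
    (h : ι → Γ) (φ : ι → Γ → ℝ) {C : ℝ} (hC : ∀ i x, |φ i x| ≤ C) {u : ℝ}
    (hu : ∀ x, u ≤ ∑ i, (φ i (h i * x) - φ i x)) : u ≤ 0 := by
  obtain ⟨m, hpos, hone, hinv⟩ := hΓ
  have hmem : ∀ (i : ι) (g : Γ), Memℓp (fun x => φ i (g * x)) ∞ := fun i g =>
    memℓp_infty ⟨C, by rintro _ ⟨x, rfl⟩; exact hC i _⟩
  let ψ : ι → Γ → lp (fun _ : Γ => ℝ) ∞ := fun i g => ⟨fun x => φ i (g * x), hmem i g⟩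
  have hψ : ∀ i g x, ψ i g x = φ i (g * x) := fun _ _ _ => rfl
  have h1 : ∀ i, m (ψ i (h i)) = m (ψ i 1) := fun i =>
    hinv (h i)⁻¹ _ _ fun x => by simp [hψ]
  -- By invariance the mean of the sum vanishes, which leaves `-u`.
  have h2 : 0 ≤ m (∑ i, (ψ i (h i) - ψ i 1) - u • 1) := by
    refine hpos _ fun x => ?_
    have := hu x
    simp only [lp.coeFn_sub, lp.coeFn_sum, lp.coeFn_smul, lp.infty_coeFn_one, Pi.sub_apply,
      Finset.sum_apply, Pi.smul_apply, Pi.one_apply, hψ, one_mul, smul_eq_mul, mul_one]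
    linarith
  simpa [h1, hone] using h2

/-- Approximately invariant probability densities, carried over from an amenable subgroup. -/
theorem exists_almost_invariant_density {K : Subgroup Γ} (hK : IsAmenableGroup K)
    {S : Finset Γ} (hS : (S : Set Γ) ⊆ K) {ε : ℝ} (hε : 0 < ε) :
    ∃ f : Γ → ℝ, (∀ x, 0 ≤ f x) ∧ HasSum f 1 ∧ ∀ h ∈ S,
      Summable (fun x => |f (h⁻¹ * x) - f x|) ∧ ∑' x, |f (h⁻¹ * x) - f x| < ε := by
  classical
  let C : Set (S → lp (fun _ : Γ => ℝ) 1) := {v | ∃ f : Γ → ℝ, (∀ x, 0 ≤ f x) ∧ HasSum f 1 ∧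
    ∀ (h : S) x, v h x = f ((h : Γ)⁻¹ * x) - f x}
  have hC : Convex ℝ C := by
    rintro v ⟨f, hf, hf1, hfv⟩ w ⟨g, hg, hg1, hgw⟩ a b ha hb hab
    refine ⟨fun x => a * f x + b * g x, fun x => ?_, ?_, fun h x => ?_⟩
    · have := hf x
      have := hg x
      positivity
    · simpa [hab] using (hf1.mul_left a).add (hg1.mul_left b)
    · simp only [Pi.add_apply, Pi.smul_apply, lp.coeFn_add, lp.coeFn_smul, hfv, hgw, smul_eq_mul]
      ring
  let δ : Γ → lp (fun _ : Γ => ℝ) 1 := fun x => lp.single 1 x 1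
  have hδ : ∀ x : Γ, (fun h : S => δ (h * x) - δ x) ∈ C := by
    intro x
    refine ⟨Pi.single x 1, fun y => ?_, hasSum_pi_single x 1, fun h y => ?_⟩
    · by_cases hy : y = x
      · subst hy; simp
      · simp [hy]
    · simp only [lp.coeFn_sub, Pi.sub_apply, δ, lp.coeFn_single, Pi.single_apply,
        inv_mul_eq_iff_eq_mul]
  -- Otherwise Hahn-Banach separates 0 from the convex set `C` by a constant `u > 0`. Evaluating the
  -- functional on point masses at elements of `K` only gives bounded functions on `K` that
  -- contradict `sum_translate_sub_le`.
  have h0 : (0 : S → lp (fun _ : Γ => ℝ) 1) ∈ closure C := by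
    by_contra hn
    obtain ⟨Φ, u, hu0, hu⟩ := geometric_hahn_banach_point_closed hC.closure isClosed_closure hn
    rw [map_zero] at hu0
    have hbd : ∀ (i : S) (x : K), |Φ (Pi.single i (δ x))| ≤ ‖Φ‖ := by
      intro i x
      have h1 := Φ.le_opNorm (Pi.single i (δ x))
      have h2 : ‖(Pi.single i (δ x) : S → lp (fun _ : Γ => ℝ) 1)‖ = 1 := by
        rw [Pi.norm_single]
        simp [δ, lp.norm_single]
      rwa [h2, mul_one] at h1
    refine absurd (hK.sum_translate_sub_le (fun i : S => (⟨i, hS i.2⟩ : K))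
      (fun i x => Φ (Pi.single i (δ x))) hbd (u := u) fun x => ?_) (not_le.2 hu0)
    have h1 := (hu _ (subset_closure (hδ x))).le
    have h2 : (fun h : S => δ (h * x) - δ x) =
        ∑ i : S, (Pi.single i (δ (i * x)) - Pi.single i (δ x)) := by
      simp only [← Pi.single_sub]
      exact (Finset.univ_sum_single _).symm
    rw [h2, map_sum] at h1
    simpa using h1
  obtain ⟨v, ⟨f, hf, hf1, hfv⟩, hv⟩ := Metric.mem_closure_iff.1 h0 ε hε
  rw [dist_zero_left] at hv
  refine ⟨f, hf, hf1, fun h hh => ?_⟩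
  have h1 : (fun x => |f (h⁻¹ * x) - f x|) = fun x => ‖v ⟨h, hh⟩ x‖ := by
    funext x
    rw [hfv, Real.norm_eq_abs]
  have h2 := lp.norm_eq_tsum_rpow (p := 1) (by norm_num) (v ⟨h, hh⟩)
  have h3 := (lp.memℓp (v ⟨h, hh⟩)).summable (by norm_num)
  simp only [ENNReal.toReal_one, Real.rpow_one, one_div, inv_one] at h2 h3
  rw [h1, ← h2]
  exact ⟨h3, (norm_le_pi_norm v _).trans_lt hv⟩

/-- Factor the difference and use |√a - √b| ≤ √a + √b. This turns ℓ¹ estimates for a density into ℓ²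
estimates for its square root. -/
theorem sq_sqrt_sub_sqrt_le {a b : ℝ} (ha : 0 ≤ a) (hb : 0 ≤ b) : (√a - √b) ^ 2 ≤ |a - b| := by
  have h : a - b = (√a - √b) * (√a + √b) := by
    ring_nf
    rw [Real.sq_sqrt ha, Real.sq_sqrt hb]
  have h1 := Real.sqrt_nonneg a
  have h2 := Real.sqrt_nonneg b
  rw [h, abs_mul, ← sq_abs, sq, abs_of_nonneg (add_nonneg h1 h2)]
  refine mul_le_mul_of_nonneg_left ?_ (abs_nonneg _)
  rw [abs_le]
  constructor <;> linarith

/-- Almost invariant unit vectors, carried over from an amenable subgroup. -/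
theorem exists_almost_invariant_vector {K : Subgroup Γ} (hK : IsAmenableGroup K)
    {S : Finset Γ} (hS : (S : Set Γ) ⊆ K) {ε : ℝ} (hε : 0 < ε) :
    ∃ ξ : lp (fun _ : Γ => ℂ) 2, ‖ξ‖ = 1 ∧
      ∀ h ∈ S, ‖leftRegularRepresentation Γ h ξ - ξ‖ < ε := by
  obtain ⟨f, hf, hf1, hfS⟩ := exists_almost_invariant_density hK hS (pow_pos hε 2)
  have hsq : ∀ x, ‖((√(f x) : ℝ) : ℂ)‖ ^ 2 = f x := fun x => by
    rw [Complex.norm_real, Real.norm_eq_abs, sq_abs, Real.sq_sqrt (hf x)]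
  have hmem : Memℓp (fun x => ((√(f x) : ℝ) : ℂ)) 2 := by
    refine memℓp_gen ?_
    simpa [Real.sq_sqrt (hf _)] using hf1.summable
  have hnorm : ∀ ζ : lp (fun _ : Γ => ℂ) 2, ‖ζ‖ ^ 2 = ∑' x, ‖ζ x‖ ^ 2 := fun ζ => by
    have := lp.norm_rpow_eq_tsum (p := 2) (by norm_num) ζ
    simpa using this
  refine ⟨⟨_, hmem⟩, ?_, fun h hh => ?_⟩
  · have := hnorm ⟨_, hmem⟩
    simp only [hsq, hf1.tsum_eq] at this
    exact (pow_eq_one_iff_of_nonneg (norm_nonneg _) two_ne_zero).1 this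
  · refine lt_of_pow_lt_pow_left₀ 2 hε.le ((hnorm _).trans_lt ?_)
    have hle : ∀ x, ‖(leftRegularRepresentation Γ h ⟨_, hmem⟩ -
        (⟨_, hmem⟩ : lp (fun _ : Γ => ℂ) 2)) x‖ ^ 2 ≤ |f (h⁻¹ * x) - f x| := fun x => by
      rw [lp.coeFn_sub, Pi.sub_apply, leftRegularRepresentation_apply]
      change ‖((√(f (h⁻¹ * x)) : ℝ) : ℂ) - ((√(f x) : ℝ) : ℂ)‖ ^ 2 ≤ _
      rw [← Complex.ofReal_sub, Complex.norm_real, Real.norm_eq_abs, sq_abs]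
      exact sq_sqrt_sub_sqrt_le (hf _) (hf _)
    obtain ⟨h1, h2⟩ := hfS h hh
    exact (Summable.tsum_le_tsum hle (h1.of_nonneg_of_le (fun _ => sq_nonneg _) hle) h1).trans_lt h2

/-- A filter of almost invariant unit vectors for a set each finite part of which is contained in
an amenable subgroup. -/
theorem exists_filter_almost_invariant {H : Set Γ}
    (hH : ∀ S : Finset Γ, (S : Set Γ) ⊆ H →
      ∃ K : Subgroup Γ, IsAmenableGroup K ∧ (S : Set Γ) ⊆ K) :
    ∃ F : Filter (lp (fun _ : Γ => ℂ) 2), F.NeBot ∧ (∀ᶠ ξ in F, ‖ξ‖ = 1) ∧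
      ∀ h ∈ H, Tendsto (fun ξ => leftRegularRepresentation Γ h ξ - ξ) F (𝓝 0) := by
  classical
  -- The net is indexed by a finite part of `H` together with a precision.
  have hex : ∀ i : Finset H × ℕ, ∃ ξ : lp (fun _ : Γ => ℂ) 2, ‖ξ‖ = 1 ∧
      ∀ h ∈ i.1, ‖leftRegularRepresentation Γ (h : Γ) ξ - ξ‖ < 1 / ((i.2 : ℝ) + 1) := by
    intro i
    obtain ⟨K, hK, hSK⟩ := hH (i.1.map (Function.Embedding.subtype _)) (by
      intro x hx
      simp only [Finset.coe_map, mem_image, Function.Embedding.subtype_apply] at hx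
      obtain ⟨y, -, rfl⟩ := hx
      exact y.2)
    obtain ⟨ξ, h1, h2⟩ := exists_almost_invariant_vector hK hSK (Nat.one_div_pos_of_nat (n := i.2))
    exact ⟨ξ, h1, fun h hh => h2 h (Finset.mem_map_of_mem (Function.Embedding.subtype _) hh)⟩
  choose ξ hξ1 hξ2 using hex
  refine ⟨map ξ atTop, inferInstance, eventually_map.2 (Eventually.of_forall hξ1), fun h hh => ?_⟩
  rw [tendsto_map'_iff, Metric.tendsto_nhds]
  intro ε hε
  obtain ⟨n, hn⟩ := exists_nat_one_div_lt hε
  filter_upwards [eventually_ge_atTop (({⟨h, hh⟩}, n) : Finset H × ℕ)] with i hi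
  simp only [Function.comp_apply, dist_zero_right]
  refine (hξ2 i ⟨h, hh⟩ (hi.1 (Finset.mem_singleton_self _))).trans_le (le_trans ?_ hn.le)
  have : (n : ℝ) ≤ i.2 := Nat.cast_le.2 hi.2
  gcongr

end Amenable

end

/-! ### Ample groupoids: orbits and swaps -/

namespace AmpleGroupoid

variable {X G : Type*} [TopologicalSpace X] [TopologicalSpace G] (𝒢 : AmpleGroupoid X G)

theorem isOpenMap_r : IsOpenMap 𝒢.r := IsLocalHomeomorph.isOpenMap 𝒢.isEtale

theorem isOpenMap_s : IsOpenMap 𝒢.s := by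
  intro U hU
  have h : 𝒢.s '' U = 𝒢.r '' (𝒢.inv ⁻¹' U) := by
    ext x
    constructor
    · rintro ⟨g, hg, rfl⟩
      exact ⟨𝒢.inv g, by simpa [𝒢.inv_inv] using hg, 𝒢.r_inv g⟩
    · rintro ⟨g, hg, rfl⟩
      exact ⟨𝒢.inv g, hg, 𝒢.s_inv g⟩
  rw [h]
  exact 𝒢.isOpenMap_r _ (hU.preimage 𝒢.continuous_inv)

theorem exists_compactOpenBisection {g : G} {W : Set G} (hW : IsOpen W) (hg : g ∈ W) :
    ∃ B ∈ 𝒢.compactOpenBisections, g ∈ B ∧ B ⊆ W :=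
  𝒢.isAmple.mem_nhds_iff.1 (hW.mem_nhds hg)

/-- The unit space of an ample groupoid is zero-dimensional. -/
theorem exists_isClopen (𝒢 : AmpleGroupoid X G) [T2Space X] {x : X} {V : Set X} (hV : IsOpen V) (hx : x ∈ V) :
    ∃ U, IsClopen U ∧ x ∈ U ∧ U ⊆ V := by
  -- The range of a compact open bisection is compact and open, hence clopen.
  obtain ⟨B, ⟨hBc, hBo, -⟩, hxB, hBV⟩ := 𝒢.exists_compactOpenBisection
    (hV.preimage 𝒢.continuous_r) (show 𝒢.unit x ∈ 𝒢.r ⁻¹' V by simpa [𝒢.r_unit] using hx)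
  exact ⟨𝒢.r '' B, ⟨(hBc.image 𝒢.continuous_r).isClosed, 𝒢.isOpenMap_r _ hBo⟩,
    ⟨_, hxB, 𝒢.r_unit x⟩, image_subset_iff.2 hBV⟩

/-- The orbit of a unit. -/
def orbit (x : X) : Set X := {y | ∃ g, 𝒢.s g = x ∧ 𝒢.r g = y}

theorem mem_orbit_self (x : X) : x ∈ 𝒢.orbit x := ⟨𝒢.unit x, 𝒢.s_unit x, 𝒢.r_unit x⟩

theorem isInvariant_orbit (x : X) : 𝒢.IsInvariant (𝒢.orbit x) := by
  rintro g ⟨h, hx, hg⟩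
  exact ⟨𝒢.mul g h, by rw [𝒢.s_mul _ _ hg.symm, hx], 𝒢.r_mul _ _ hg.symm⟩

theorem exists_arrow_of_mem_orbit {x y z : X} (hy : y ∈ 𝒢.orbit x) (hz : z ∈ 𝒢.orbit x) :
    ∃ g, 𝒢.s g = y ∧ 𝒢.r g = z := by
  obtain ⟨g, hgx, rfl⟩ := hy
  obtain ⟨h, hhx, rfl⟩ := hz
  have H : 𝒢.s h = 𝒢.r (𝒢.inv g) := by rw [𝒢.r_inv, hgx, hhx]
  exact ⟨𝒢.mul h (𝒢.inv g), by rw [𝒢.s_mul _ _ H, 𝒢.s_inv], 𝒢.r_mul _ _ H⟩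

/-- Finite sets are closed, and orbits are invariant. -/
theorem orbit_eq_univ_of_finite [T1Space X] (hmin : 𝒢.IsMinimal) {x : X}
    (hx : (𝒢.orbit x).Finite) : 𝒢.orbit x = univ :=
  hmin _ hx.isClosed ⟨x, 𝒢.mem_orbit_self x⟩ (𝒢.isInvariant_orbit x)

theorem infinite_orbit [T1Space X] [Infinite X] (hmin : 𝒢.IsMinimal) (x : X) :
    (𝒢.orbit x).Infinite := fun h =>
  infinite_univ (𝒢.orbit_eq_univ_of_finite hmin h ▸ h)

/-- The element of the full group that exchanges source and range of a bisection for which these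
are disjoint, and is trivial elsewhere. -/
def swap [CompactSpace X] [T2Space X] {B : Set G} (hB : B ∈ 𝒢.compactOpenBisections)
    (hd : Disjoint (𝒢.s '' B) (𝒢.r '' B)) : TopologicalFullGroup 𝒢 where
  carrier := B ∪ 𝒢.inv ⁻¹' B ∪ 𝒢.unit '' (𝒢.s '' B ∪ 𝒢.r '' B)ᶜ
  isCompact := by
    have h1 : 𝒢.inv ⁻¹' B = 𝒢.inv '' B :=
      (congrFun (image_eq_preimage_of_inverse 𝒢.inv_inv 𝒢.inv_inv) B).symm
    rw [h1]
    refine (hB.1.union (hB.1.image 𝒢.continuous_inv)).union (IsCompact.image ?_ 𝒢.continuous_unit)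
    exact ((𝒢.isOpenMap_s _ hB.2.1).union (𝒢.isOpenMap_r _ hB.2.1)).isClosed_compl.isCompact
  isOpen := by
    have h1 : ∀ C : Set X, 𝒢.unit '' C = range 𝒢.unit ∩ 𝒢.r ⁻¹' C := fun C => by
      ext g
      constructor
      · rintro ⟨x, hx, rfl⟩
        exact ⟨⟨x, rfl⟩, by simpa [𝒢.r_unit] using hx⟩
      · rintro ⟨⟨x, rfl⟩, hx⟩
        exact ⟨x, by simpa [𝒢.r_unit] using hx, rfl⟩
    rw [h1]
    refine (hB.2.1.union (hB.2.1.preimage 𝒢.continuous_inv)).union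
      (𝒢.isOpen_range_unit.inter (IsOpen.preimage 𝒢.continuous_r ?_))
    exact (((hB.1.image 𝒢.continuous_s).union (hB.1.image 𝒢.continuous_r)).isClosed).isOpen_compl
  isBisection := by
    -- Rules out an arrow of `B` and an inverse arrow with a common range or a common source.
    have hne : ∀ a ∈ B, ∀ b ∈ B, 𝒢.s a ≠ 𝒢.r b := fun a ha b hb h =>
      disjoint_left.1 hd ⟨a, ha, rfl⟩ ⟨b, hb, h.symm⟩
    have hinj : ∀ a b, 𝒢.inv a = 𝒢.inv b → a = b := fun a b h => by
      rw [← 𝒢.inv_inv a, h, 𝒢.inv_inv]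
    constructor
    · rintro a ((ha | ha) | ⟨x, hx, rfl⟩) b ((hb | hb) | ⟨y, hy, rfl⟩) h
      · exact hB.2.2.1 ha hb h
      · exact absurd (h ▸ 𝒢.s_inv b) (hne _ hb _ ha)
      · exact absurd (Or.inr ⟨a, ha, h.trans (𝒢.r_unit y)⟩) hy
      · exact absurd (h ▸ 𝒢.s_inv a) (hne _ ha _ hb)
      · exact hinj _ _ (hB.2.2.2 ha hb (by rw [𝒢.s_inv, 𝒢.s_inv, h]))
      · exact absurd (Or.inl ⟨_, ha, by rw [𝒢.s_inv, h, 𝒢.r_unit]⟩) hy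
      · exact absurd (Or.inr ⟨b, hb, h.symm.trans (𝒢.r_unit x)⟩) hx
      · exact absurd (Or.inl ⟨_, hb, by rw [𝒢.s_inv, ← h, 𝒢.r_unit]⟩) hx
      · rw [𝒢.r_unit, 𝒢.r_unit] at h
        rw [h]
    · rintro a ((ha | ha) | ⟨x, hx, rfl⟩) b ((hb | hb) | ⟨y, hy, rfl⟩) h
      · exact hB.2.2.2 ha hb h
      · exact absurd (h.trans (𝒢.r_inv b).symm) (hne _ ha _ hb)
      · exact absurd (Or.inl ⟨a, ha, h.trans (𝒢.s_unit y)⟩) hy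
      · exact absurd (h.symm.trans (𝒢.r_inv a).symm) (hne _ hb _ ha)
      · exact hinj _ _ (hB.2.2.1 ha hb (by rw [𝒢.r_inv, 𝒢.r_inv, h]))
      · exact absurd (Or.inr ⟨_, ha, by rw [𝒢.r_inv, h, 𝒢.s_unit]⟩) hy
      · exact absurd (Or.inl ⟨b, hb, h.symm.trans (𝒢.s_unit x)⟩) hx
      · exact absurd (Or.inr ⟨_, hb, by rw [𝒢.r_inv, ← h, 𝒢.s_unit]⟩) hx
      · rw [𝒢.s_unit, 𝒢.s_unit] at h
        rw [h]
  image_r := by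
    refine eq_univ_of_forall fun x => ?_
    by_cases hx : x ∈ 𝒢.s '' B ∪ 𝒢.r '' B
    · rcases hx with ⟨b, hb, rfl⟩ | ⟨b, hb, rfl⟩
      · exact ⟨𝒢.inv b, Or.inl (Or.inr (by simpa [𝒢.inv_inv] using hb)), 𝒢.r_inv b⟩
      · exact ⟨b, Or.inl (Or.inl hb), rfl⟩
    · exact ⟨𝒢.unit x, Or.inr ⟨x, hx, rfl⟩, 𝒢.r_unit x⟩
  image_s := by
    refine eq_univ_of_forall fun x => ?_
    by_cases hx : x ∈ 𝒢.s '' B ∪ 𝒢.r '' B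
    · rcases hx with ⟨b, hb, rfl⟩ | ⟨b, hb, rfl⟩
      · exact ⟨b, Or.inl (Or.inl hb), rfl⟩
      · exact ⟨𝒢.inv b, Or.inl (Or.inr (by simpa [𝒢.inv_inv] using hb)), 𝒢.s_inv b⟩
    · exact ⟨𝒢.unit x, Or.inr ⟨x, hx, rfl⟩, 𝒢.s_unit x⟩

/-- Rigid stabilisers of open sets containing source and range of an arrow that is not in an
isotropy group are nontrivial. -/
theorem exists_mem_rigidStabiliser_ne_one [CompactSpace X] [T2Space X] {g : G}
    (hg : 𝒢.s g ≠ 𝒢.r g) {V : Set X} (hV : IsOpen V) (hs : 𝒢.s g ∈ V) (hr : 𝒢.r g ∈ V) :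
    ∃ a ∈ TopologicalFullGroup.rigidStabiliser 𝒢 V, a ≠ 1 := by
  obtain ⟨V₁, V₂, ho₁, ho₂, hs₁, hr₂, hdisj⟩ := t2_separation hg
  -- Shrinking around `g` keeps sources and ranges apart and inside `V`, so the swap is supported in
  -- `V` and moves `𝒢.s g`.
  obtain ⟨B, hB, hgB, hBW⟩ := 𝒢.exists_compactOpenBisection
    (((ho₁.inter hV).preimage 𝒢.continuous_s).inter ((ho₂.inter hV).preimage 𝒢.continuous_r))
    (show g ∈ _ from ⟨⟨hs₁, hs⟩, ⟨hr₂, hr⟩⟩)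
  have hd : Disjoint (𝒢.s '' B) (𝒢.r '' B) := hdisj.mono
    (image_subset_iff.2 fun b hb => (hBW hb).1.1) (image_subset_iff.2 fun b hb => (hBW hb).2.1)
  refine ⟨𝒢.swap hB hd, ?_, fun h => ?_⟩
  · refine (mem_fixingSubgroup_iff _).2 fun y hy => ?_
    have hy' : 𝒢.unit y ∈ (𝒢.swap hB hd).carrier := by
      refine Or.inr ⟨y, fun h => hy ?_, rfl⟩
      rcases h with ⟨b, hb, rfl⟩ | ⟨b, hb, rfl⟩
      · exact (hBW hb).1.2
      · exact (hBW hb).2.2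
    have := TopologicalFullGroup.smul_source _ hy'
    rwa [𝒢.s_unit, 𝒢.r_unit] at this
  · have h1 : g ∈ (𝒢.swap hB hd).carrier := Or.inl (Or.inl hgB)
    have h2 := TopologicalFullGroup.smul_source _ h1
    rw [h, one_smul] at h2
    exact hg h2

end AmpleGroupoid

/-! ### The action of the full group and its rigid stabilisers -/

namespace TopologicalFullGroup

variable {X G : Type*} [TopologicalSpace X] [TopologicalSpace G] {𝒢 : AmpleGroupoid X G}

theorem continuous_smul (A : TopologicalFullGroup 𝒢) : Continuous fun x : X => A • x := by
  rw [continuous_def]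
  intro V hV
  have h : (fun x : X => A • x) ⁻¹' V = 𝒢.s '' (A.carrier ∩ 𝒢.r ⁻¹' V) := by
    ext x
    constructor
    · intro hx
      obtain ⟨a, ha, rfl⟩ := A.exists_s x
      rw [mem_preimage, smul_source A ha] at hx
      exact ⟨a, ⟨ha, hx⟩, rfl⟩
    · rintro ⟨a, ⟨ha, hV⟩, rfl⟩
      rw [mem_preimage, smul_source A ha]
      exact hV
  rw [h]
  exact 𝒢.isOpenMap_s _ (A.isOpen.inter (hV.preimage 𝒢.continuous_r))

variable [CompactSpace X] [T2Space X]

/-- A non-unit arrow in a full bisection would, by the germs condition, force that bisection to move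
a point. -/
theorem faithfulSMul (hgerms : 𝒢.IsGroupoidOfGerms) : FaithfulSMul (TopologicalFullGroup 𝒢) X := by
  refine ⟨fun {A B} h => ?_⟩
  suffices ∀ C : TopologicalFullGroup 𝒢, (∀ x : X, C • x = x) → C = 1 by
    refine (inv_mul_eq_one.1 (this (B⁻¹ * A) fun x => ?_)).symm
    rw [mul_smul, h x, inv_smul_smul]
  intro C hC
  have hsub : ∀ a ∈ C.carrier, a ∈ range 𝒢.unit := by
    intro a ha
    by_contra hn
    obtain ⟨h, hhC, hh⟩ := hgerms a hn C.carrier ⟨C.isCompact, C.isOpen, C.isBisection⟩ ha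
    exact hh ((hC _).symm.trans (smul_source C hhC))
  ext g
  refine ⟨hsub g, ?_⟩
  rintro ⟨x, rfl⟩
  obtain ⟨a, ha, hax⟩ := C.exists_s x
  obtain ⟨y, rfl⟩ := hsub a ha
  rw [𝒢.s_unit] at hax
  exact hax ▸ ha

theorem mem_rigidStabiliser {U : Set X} {A : TopologicalFullGroup 𝒢} :
    A ∈ rigidStabiliser 𝒢 U ↔ ∀ x ∉ U, A • x = x :=
  mem_fixingSubgroup_iff _

theorem rigidStabiliser_mono {U V : Set X} (h : U ⊆ V) :
    rigidStabiliser 𝒢 U ≤ rigidStabiliser 𝒢 V := fun _ hA =>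
  mem_rigidStabiliser.2 fun x hx => mem_rigidStabiliser.1 hA x fun hxU => hx (h hxU)

/-- Translates the position of `B • x` relative to `U` into the position of `x` relative to the
support of the conjugate. -/
theorem conj_mem_rigidStabiliser {U : Set X} {A : TopologicalFullGroup 𝒢}
    (hA : A ∈ rigidStabiliser 𝒢 U) (B : TopologicalFullGroup 𝒢) :
    B⁻¹ * A * B ∈ rigidStabiliser 𝒢 ((fun x : X => B • x) ⁻¹' U) :=
  mem_rigidStabiliser.2 fun x hx => by
    rw [mul_smul, mul_smul, mem_rigidStabiliser.1 hA _ hx, inv_smul_smul]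

/-- Permutations with disjoint supports commute, and faithfulness lifts this to the group. -/
theorem commute_of_disjoint (hgerms : 𝒢.IsGroupoidOfGerms) {U V : Set X} (hUV : Disjoint U V)
    {A B : TopologicalFullGroup 𝒢} (hA : A ∈ rigidStabiliser 𝒢 U)
    (hB : B ∈ rigidStabiliser 𝒢 V) : Commute A B := by
  have := faithfulSMul hgerms
  have h : (MulAction.toPerm A : Equiv.Perm X).Disjoint (MulAction.toPerm B) := fun x => by
    by_cases hx : x ∈ U
    · exact Or.inr (mem_rigidStabiliser.1 hB x (disjoint_left.1 hUV hx))
    · exact Or.inl (mem_rigidStabiliser.1 hA x hx)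
  exact Commute.of_map (f := MulAction.toPermHom (TopologicalFullGroup 𝒢) X)
    MulAction.toPerm_injective h.commute

/-- If the unit space is infinite, there are nontrivial elements of the full group with disjoint
clopen supports. -/
theorem exists_disjoint_rigidStabiliser_ne_one [Infinite X] (hmin : 𝒢.IsMinimal) :
    ∃ U V : Set X, IsClopen U ∧ IsClopen V ∧ Disjoint U V ∧
      (∃ A ∈ rigidStabiliser 𝒢 U, A ≠ 1) ∧ ∃ B ∈ rigidStabiliser 𝒢 V, B ≠ 1 := by
  obtain ⟨x⟩ : Nonempty X := inferInstance
  let e := (𝒢.infinite_orbit hmin x).natEmbedding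
  have he : ∀ i j, i ≠ j → (e i : X) ≠ e j := fun i j hij h =>
    hij (e.injective (Subtype.ext h))
  -- Four points of one orbit suffice: a clopen set contains the first two and misses the last two,
  -- and an arrow within each pair supplies a swap on its side.
  have hsep : ∀ i : ℕ, i = 0 ∨ i = 1 → ∃ W : Set X, IsClopen W ∧ (e i : X) ∈ W ∧
      W ⊆ {(e 2 : X), (e 3 : X)}ᶜ := fun i hi =>
    𝒢.exists_isClopen ((finite_singleton _).insert _).isClosed.isOpen_compl (by
      have h2 : i ≠ 2 := by omega
      have h3 : i ≠ 3 := by omega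
      simp [he i 2 h2, he i 3 h3])
  obtain ⟨W₀, hW₀, h0, hW₀'⟩ := hsep 0 (Or.inl rfl)
  obtain ⟨W₁, hW₁, h1, hW₁'⟩ := hsep 1 (Or.inr rfl)
  obtain ⟨g, hgs, hgr⟩ := 𝒢.exists_arrow_of_mem_orbit (e 0).2 (e 1).2
  obtain ⟨h, hhs, hhr⟩ := 𝒢.exists_arrow_of_mem_orbit (e 2).2 (e 3).2
  have hW := hW₀.union hW₁
  have hW' := union_subset hW₀' hW₁'
  refine ⟨W₀ ∪ W₁, (W₀ ∪ W₁)ᶜ, hW, hW.compl, disjoint_compl_right,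
    𝒢.exists_mem_rigidStabiliser_ne_one (g := g) ?_ hW.isOpen ?_ ?_,
    𝒢.exists_mem_rigidStabiliser_ne_one (g := h) ?_ hW.compl.isOpen ?_ ?_⟩
  · rw [hgs, hgr]; exact he 0 1 (by norm_num)
  · rw [hgs]; exact Or.inl h0
  · rw [hgr]; exact Or.inr h1
  · rw [hhs, hhr]; exact he 2 3 (by norm_num)
  · rw [hhs]; exact fun hm => hW' hm (Or.inl rfl)
  · rw [hhr]; exact fun hm => hW' hm (Or.inr rfl)

/-- A finite set of elements, each trivial near `x`, lies in the rigid stabiliser of a clopen set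
that avoids `x`. -/
theorem exists_subset_rigidStabiliser {x : X} (S : Finset (TopologicalFullGroup 𝒢))
    (hS : (S : Set (TopologicalFullGroup 𝒢)) ⊆
      {A | ∃ U, IsClopen U ∧ x ∉ U ∧ A ∈ rigidStabiliser 𝒢 U}) :
    ∃ U : Set X, IsClopen U ∧ x ∉ U ∧ (S : Set (TopologicalFullGroup 𝒢)) ⊆ rigidStabiliser 𝒢 U := by
  have hS' : ∀ A ∈ S, ∃ U, IsClopen U ∧ x ∉ U ∧ A ∈ rigidStabiliser 𝒢 U := fun A hA => hS hA
  choose! U hU hx hA using hS'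
  refine ⟨⋃ A ∈ S, U A, S.finite_toSet.isClopen_biUnion fun A hA => hU A hA, ?_, fun A hAS => ?_⟩
  · simp only [mem_iUnion, not_exists]
    exact hx
  · exact rigidStabiliser_mono (subset_biUnion_of_mem (u := U) hAS) (hA A hAS)

theorem nontrivial_of_finite [Finite X] [Nontrivial X] (hmin : 𝒢.IsMinimal) :
    ∃ A : TopologicalFullGroup 𝒢, A ≠ 1 := by
  obtain ⟨x, y, hxy⟩ := exists_pair_ne X
  have hy : y ∈ 𝒢.orbit x := 𝒢.orbit_eq_univ_of_finite hmin (toFinite _) ▸ mem_univ y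
  obtain ⟨g, rfl, rfl⟩ := hy
  obtain ⟨A, -, hA⟩ := 𝒢.exists_mem_rigidStabiliser_ne_one hxy isOpen_univ trivial trivial
  exact ⟨A, hA⟩

end TopologicalFullGroup

theorem theorem5p4 {X : Type*} {G : Type*} [TopologicalSpace X] [TopologicalSpace G]
    [CompactSpace X] [T2Space X] [Nontrivial X] (𝒢 : AmpleGroupoid X G)
    (hgerms : 𝒢.IsGroupoidOfGerms) (hmin : 𝒢.IsMinimal)
    (hrigid : ∀ U : Set X, IsClopen U → U ≠ univ →
      IsAmenableGroup (TopologicalFullGroup.rigidStabiliser 𝒢 U)) :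
    ¬ IsCStarSimpleGroup (TopologicalFullGroup 𝒢) := by
  rcases finite_or_infinite X with hX | hX
  · have := TopologicalFullGroup.faithfulSMul hgerms
    have : Finite (TopologicalFullGroup 𝒢) :=
      Finite.of_injective (fun A => (MulAction.toPerm A : Equiv.Perm X)) MulAction.toPerm_injective
    obtain ⟨A, hA⟩ := TopologicalFullGroup.nontrivial_of_finite hmin
    obtain ⟨F, _, hF, hinv⟩ := exists_filter_almost_invariant
      (H := (univ : Set (TopologicalFullGroup 𝒢))) fun S _ =>
        ⟨⊤, IsAmenableGroup.of_finite _, fun _ _ => trivial⟩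
    exact not_isCStarSimpleGroup_of_commute hF hinv hA hA (Commute.refl A)
      fun _ => Or.inl trivial
  · obtain ⟨U, V, hU, hV, hUV, ⟨A, hAU, hA⟩, B, hBV, hB⟩ :=
      TopologicalFullGroup.exists_disjoint_rigidStabiliser_ne_one hmin
    obtain ⟨x⟩ : Nonempty X := inferInstance
    obtain ⟨F, _, hF, hinv⟩ := exists_filter_almost_invariant
      (H := {A | ∃ U, IsClopen U ∧ x ∉ U ∧ A ∈ TopologicalFullGroup.rigidStabiliser 𝒢 U})
      fun S hS => by
        obtain ⟨W, hW, hx, hSW⟩ := TopologicalFullGroup.exists_subset_rigidStabiliser S hS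
        exact ⟨_, hrigid W hW fun h => hx (h ▸ mem_univ x), hSW⟩
    refine not_isCStarSimpleGroup_of_commute hF hinv hA hB
      (TopologicalFullGroup.commute_of_disjoint hgerms hUV hAU hBV) fun C => ?_
    -- The conjugate to use is that of the element whose support misses `C • x`.
    by_cases hx : C • x ∈ U
    · exact Or.inr ⟨_, hV.preimage C.continuous_smul, disjoint_left.1 hUV hx,
        TopologicalFullGroup.conj_mem_rigidStabiliser hBV C⟩
    · exact Or.inl ⟨_, hU.preimage C.continuous_smul, hx,
        TopologicalFullGroup.conj_mem_rigidStabiliser hAU C⟩
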